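/- An \emph{(abstract) $n$-polytope} is a partially ordered set $\mathcal P$ of faces with a strictly monotone rank function with values in $\{-1,0,\dots,n\}$ such that: (1) there is a least face, of rank $-1$, and a greatest face, of rank $n$; (2) every flag (maximal chain) contains exactly $n+2$ faces, one of each rank; (3) whenever $F<G$ and $\operatorname{rank} G-\operatorname{rank} F=2$, there are exactly two faces $H$ of rank $\operatorname{rank}F+1$ with $F<H<G$; (4) whenever $F<G$ and $\operatorname{rank} G-\operatorname{rank} F\ge 3$, any two faces strictly between $F$ and $G$ are joined by a finite sequence of faces strictly between $F$ and $G$ in which consecutive faces are comparable. Polytopes may be infinite. Its \emph{flag graph} $\mathcal G_{\mathcal P}$ has the flags as vertices, and an edge labeled $i\in\{0,\dots,n-1\}$ between two distinct flags whenever they differ only in their faces of rank $i$. A \emph{polyhedron} is a $3$-polytope, and a \emph{rooted} polytope $(\mathcal P,\Phi)$ is a polytope $\mathcal P$ with a chosen flag $\Phi$. For rooted $n$-polytopes $(\mathcal P,\Phi)$ and $(\mathcal Q,\Psi)$, let $\mathcal G$ be the edge-labeled graph whose vertices are the pairs (flag of $\mathcal P$, flag of $\mathcal Q$), with an $i$-edge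 between $(\Phi_1,\Psi_1)$ and $(\Phi_2,\Psi_2)$ if and only if there is an $i$-edge between $\Phi_1$ and $\Phi_2$ in $\mathcal G_{\mathcal P}$ and an $i$-edge between $\Psi_1$ and $\Psi_2$ in $\mathcal G_{\mathcal Q}$. The \emph{mix} $(\mathcal P,\Phi)\diamond(\mathcal Q,\Psi)$ is the connected component of $\mathcal G$ that contains $(\Phi,\Psi)$. \textbf{Theorem.} For any two rooted polyhedra $(\mathcal P,\Phi)$ and $(\mathcal Q,\Psi)$, the mix $(\mathcal P,\Phi)\diamond(\mathcal Q,\Psi)$ is polytopal: it is isomorphic, as an edge-labeled graph, to the flag graph of an abstract $3$-polytope. -/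

import Mathlib

universe u v

/-- An abstract polytope of rank `n`: a partially ordered set of faces with a strictly monotone rank
function with values in `{-1, 0, ..., n}`, satisfying the four polytope axioms.
The flags are the maximal chains, i.e. Mathlib's `Flag`. -/
structure Polytope (n : ℕ) : Type (u + 1) where
  /-- The type of faces. -/
  Face : Type u
  [order : PartialOrder Face]
  /-- The rank function. -/
  rank : Face → ℤ
  rank_strictMono : StrictMono rank
  rank_mem : ∀ F, rank F ∈ Set.Icc (-1 : ℤ) n
  /-- There is a least face, of rank `-1`. -/
  exists_least : ∃ F, IsBot F ∧ rank F = -1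
  /-- There is a greatest face, of rank `n`. -/
  exists_greatest : ∃ F, IsTop F ∧ rank F = n
  /-- Every flag contains `n + 2` faces, one of each rank. -/
  flag_rank : ∀ (Φ : Flag Face), ∀ i ∈ Set.Icc (-1 : ℤ) n, ∃! F, F ∈ Φ ∧ rank F = i
  /-- Diamond condition. -/
  diamond : ∀ F G, F < G → rank G - rank F = 2 →
    {H | rank H = rank F + 1 ∧ F < H ∧ H < G}.ncard = 2
  /-- Strong connectivity: any two faces strictly between `F` and `G` are joined by a finite sequence
  of successively incident faces strictly between `F` and `G`. -/
  strongly_connected : ∀ F G, F < G → 3 ≤ rank G - rank F →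
    ∀ H ∈ Set.Ioo F G, ∀ H' ∈ Set.Ioo F G,
      Relation.ReflTransGen
        (fun A B => A ∈ Set.Ioo F G ∧ B ∈ Set.Ioo F G ∧ (A ≤ B ∨ B ≤ A)) H H'

attribute [instance] Polytope.order

/-- A simple graph on `V` with edges labeled by `0, ..., n - 1`, given by the graph of its
`i`-edges for each label `i`. -/
def LabeledGraph (n : ℕ) (V : Type u) : Type u := Fin n → SimpleGraph V

namespace LabeledGraph

variable {n : ℕ} {V : Type u} {W : Type v}

/-- The underlying graph, forgetting labels. -/
def toGraph (G : LabeledGraph n V) : SimpleGraph V := ⨆ i, G i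

/-- The labeled subgraph induced on a set of vertices. -/
def induce (G : LabeledGraph n V) (s : Set V) : LabeledGraph n s := fun i => (G i).induce s

/-- The vertex set of the connected component containing `x`. -/
def component (G : LabeledGraph n V) (x : V) : Set V := {y | G.toGraph.Reachable x y}

/-- Label-preserving isomorphisms of labeled graphs. -/
structure Iso (G : LabeledGraph n V) (H : LabeledGraph n W) extends V ≃ W where
  map_adj_iff : ∀ i x y, (H i).Adj (toEquiv x) (toEquiv y) ↔ (G i).Adj x y

/-- The parallel product: `(x, y)` and `(x', y')` are joined by an `i`-edge iff there is an
`i`-edge between `x` and `x'` and an `i`-edge between `y` and `y'`. -/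
def parallelProduct (G : LabeledGraph n V) (H : LabeledGraph n W) : LabeledGraph n (V × W) :=
  fun i =>
    { Adj := fun a b => (G i).Adj a.1 b.1 ∧ (H i).Adj a.2 b.2
      symm := ⟨fun _ _ h => ⟨h.1.symm, h.2.symm⟩⟩
      loopless := ⟨fun _ h => (G i).loopless.irrefl _ h.1⟩ }

/-- The mix of the rooted labeled graphs `(G, x)` and `(H, y)`: the connected component of
`(x, y)` in the parallel product. -/
def rootedMix (G : LabeledGraph n V) (x : V) (H : LabeledGraph n W) (y : W) :
    LabeledGraph n ((G.parallelProduct H).component (x, y)) :=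
  (G.parallelProduct H).induce _

end LabeledGraph

namespace Polytope

variable {n : ℕ}

/-- The flag graph: two flags are joined by an `i`-edge iff they are `i`-adjacent, that is, they are
distinct and have the same faces of every rank other than `i`. -/
def flagGraph (P : Polytope.{u} n) : LabeledGraph n (Flag P.Face) :=
  fun i =>
    { Adj := fun Φ Ψ => Φ ≠ Ψ ∧ ∀ F, P.rank F ≠ ((i : ℕ) : ℤ) → (F ∈ Φ ↔ F ∈ Ψ)
      symm := ⟨fun _ _ h => ⟨h.1.symm, fun F hF => (h.2 F hF).symm⟩⟩
      loopless := ⟨fun _ h => h.1 rfl⟩ }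

end Polytope

/-- A labeled graph is polytopal if it is (isomorphic to) the flag graph of a polytope. -/
def LabeledGraph.IsPolytopal {n : ℕ} {V : Type u} (G : LabeledGraph n V) : Prop :=
  ∃ R : Polytope.{u} n, Nonempty (G.Iso R.flagGraph)

/-- A rooted `n`-polytope: an `n`-polytope with a distinguished flag. -/
structure RootedPolytope (n : ℕ) : Type (u + 1) extends Polytope.{u} n where
  /-- The base flag. -/
  base : Flag Face

/-- The mix of two rooted `n`-polytopes, as a labeled graph. -/
def RootedPolytope.mix {n : ℕ} (P : RootedPolytope.{u} n) (Q : RootedPolytope.{v} n) :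
    LabeledGraph n ((P.flagGraph.parallelProduct Q.flagGraph).component (P.base, Q.base)) :=
  P.flagGraph.rootedMix P.base Q.flagGraph Q.base

/-! The mix carries involutions, one per label, and its faces of rank `i` should be the components
left after deleting the `i`-edges, two faces being incident when they meet. `FlagSystem` lists what
makes this a polytope; its decisive axiom is `path_inter`: points joined by a path avoiding `i` and
by a path avoiding `k` are joined by one avoiding both.

In rank 3, with labels `i`, `k`, `l`, this says that such points are equal or `l`-adjacent. In each
coordinate the two flags share all faces of rank other than `l`, so the diamond condition makes them
equal or `l`-adjacent there. The danger is equality in one coordinate and adjacency in the other.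
The path avoiding `i` is a word in `k` and `l`, the same word in both coordinates. Odd words in two
fixed-point-free involutions are conjugates of a generator, hence have no fixed point. So the parity
of the word decides between equality and adjacency in both coordinates at once (`eq_or_eq_pairAdj`).
-/

/-- Two points are joined by a path all of whose labels lie in `S`. -/
def LabelConn {n : ℕ} {V : Type u} (r : Fin n → V → V) (S : Set (Fin n)) : V → V → Prop :=
  Relation.ReflTransGen fun x y => ∃ j ∈ S, y = r j x

namespace LabelConn

variable {n : ℕ} {V : Type u} {W : Type v} {r : Fin n → V → V} {S T : Set (Fin n)} {x y z : V}

theorem refl (x : V) : LabelConn r S x x := Relation.ReflTransGen.refl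

theorem trans (h : LabelConn r S x y) (h' : LabelConn r S y z) : LabelConn r S x z :=
  Relation.ReflTransGen.trans h h'

theorem step {j : Fin n} (hj : j ∈ S) (x : V) : LabelConn r S x (r j x) :=
  Relation.ReflTransGen.single ⟨j, hj, rfl⟩

theorem symm (hr : ∀ i x, r i (r i x) = x) (h : LabelConn r S x y) : LabelConn r S y x := by
  induction h with
  | refl => exact refl _
  | @tail b _ _ h ih =>
    obtain ⟨j, hj, rfl⟩ := h
    refine trans ?_ ih
    have := step (r := r) hj (r j b)
    rwa [hr] at this

theorem mono (hST : S ⊆ T) (h : LabelConn r S x y) : LabelConn r T x y :=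
  Relation.ReflTransGen.mono (fun _ _ ⟨j, hj, e⟩ => ⟨j, hST hj, e⟩) _ _ h

theorem map {r' : Fin n → W → W} (f : V → W) (hf : ∀ i x, f (r i x) = r' i (f x))
    (h : LabelConn r S x y) : LabelConn r' S (f x) (f y) :=
  Relation.ReflTransGen.lift f (fun _ _ ⟨j, hj, e⟩ => ⟨j, hj, by rw [e, hf]⟩) _ _ h

/-- A path whose labels all commute with `k` can be shifted along `k`. -/
theorem shift {k : Fin n} (hk : ∀ j ∈ S, ∀ x, r k (r j x) = r j (r k x))
    (h : LabelConn r S x y) : LabelConn r S (r k x) (r k y) :=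
  Relation.ReflTransGen.lift (r k) (fun _ _ ⟨j, hj, e⟩ => ⟨j, hj, by rw [e, hk j hj]⟩) _ _ h

end LabelConn

/-! ### Flag systems -/

/-- The labels different from `i`. -/
def labelsNe (n : ℕ) (i : ℤ) : Set (Fin n) := {j | ((j : ℕ) : ℤ) ≠ i}

/-- Involutions satisfying the conditions that characterize the flags of an abstract polytope. -/
structure FlagSystem (n : ℕ) (V : Type u) where
  /-- The involution attached to each label. -/
  r : Fin n → V → V
  invol : ∀ i x, r i (r i x) = x
  comm : ∀ i j : Fin n, (i : ℕ) + 1 < j → ∀ x, r i (r j x) = r j (r i x)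
  connected : ∀ x y, LabelConn r Set.univ x y
  separated : ∀ (i : Fin n) x, ¬ LabelConn r (labelsNe n (i : ℕ)) x (r i x)
  /-- Paths avoiding `i` and paths avoiding `k` with the same ends can be replaced by paths
  avoiding both. -/
  path_inter : ∀ i k : ℤ, i < k → ∀ x y, LabelConn r (labelsNe n i) x y →
    LabelConn r (labelsNe n k) x y → LabelConn r (labelsNe n i ∩ labelsNe n k) x y
  adjacent : ∀ (i : Fin n) x y, (∀ k ∈ Set.Icc (-1 : ℤ) n, k ≠ (i : ℕ) →
    LabelConn r (labelsNe n k) x y) → y = x ∨ y = r i x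

namespace FlagSystem

variable {n : ℕ} {V : Type u} (M : FlagSystem n V)

/-- Points with the same face of rank `i`. -/
def SameFace (i : ℤ) (x y : V) : Prop := LabelConn M.r (labelsNe n i) x y

variable {M}

theorem SameFace.refl (i : ℤ) (x : V) : M.SameFace i x x := LabelConn.refl x

theorem SameFace.symm {i : ℤ} {x y : V} (h : M.SameFace i x y) : M.SameFace i y x :=
  LabelConn.symm M.invol h

theorem SameFace.trans {i : ℤ} {x y z : V} (h : M.SameFace i x y) (h' : M.SameFace i y z) :
    M.SameFace i x z :=
  LabelConn.trans h h'

theorem comm' {i j : Fin n} (h : (i : ℕ) + 1 < j ∨ (j : ℕ) + 1 < i) (x : V) :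
    M.r i (M.r j x) = M.r j (M.r i x) :=
  h.elim (fun h => M.comm i j h x) fun h => (M.comm j i h x).symm

theorem sameFace_r {i : ℤ} {j : Fin n} (h : ((j : ℕ) : ℤ) ≠ i) (x : V) :
    M.SameFace i x (M.r j x) :=
  LabelConn.step h x

/-- A path avoiding `j` can be rearranged into labels above `j` followed by labels below `j`. -/
theorem SameFace.exists_split {j : ℤ} {x y : V} (h : M.SameFace j x y) :
    ∃ z, (∀ i ≤ j, M.SameFace i x z) ∧ ∀ k ≥ j, M.SameFace k z y := by
  suffices ∃ z, LabelConn M.r {l | j < ((l : ℕ) : ℤ)} x z ∧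
      LabelConn M.r {l | ((l : ℕ) : ℤ) < j} z y by
    obtain ⟨z, h₁, h₂⟩ := this
    refine ⟨z, fun i hi => h₁.mono fun l hl => ?_, fun k hk => h₂.mono fun l hl => ?_⟩
    · simp only [Set.mem_ofPred_eq, labelsNe] at hl ⊢; omega
    · simp only [Set.mem_ofPred_eq, labelsNe] at hl ⊢; omega
  induction h with
  | refl => exact ⟨x, LabelConn.refl _, LabelConn.refl _⟩
  | tail _ h ih =>
    obtain ⟨m, hm, rfl⟩ := h
    obtain ⟨z, h₁, h₂⟩ := ih
    rcases lt_or_gt_of_ne hm with hm | hm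
    · exact ⟨z, h₁, h₂.trans (LabelConn.step (S := {l : Fin n | ((l : ℕ) : ℤ) < j}) hm _)⟩
    -- A label above `j` differs by at least 2 from every label below `j`, so it commutes past the
    -- second half and joins the first.
    · refine ⟨M.r m z, h₁.trans (LabelConn.step (S := {l : Fin n | j < ((l : ℕ) : ℤ)}) hm _),
        h₂.shift fun l hl => comm' (Or.inr ?_)⟩
      simp only [Set.mem_ofPred_eq] at hl
      omega

/-! ### Faces and incidence -/

variable (M)

/-- A face of rank `i`: a connected component after deleting the edges of label `i`. -/
@[ext]
structure Face where
  /-- The rank. -/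
  rk : Set.Icc (-1 : ℤ) n
  /-- The points incident with the face. -/
  carrier : Set V
  exists_eq : ∃ x, carrier = {y | M.SameFace rk x y}

/-- The face of rank `i` at `x`. -/
def face (i : Set.Icc (-1 : ℤ) n) (x : V) : M.Face := ⟨i, {y | M.SameFace i x y}, x, rfl⟩

variable {M}

theorem mem_face {i : Set.Icc (-1 : ℤ) n} {x y : V} :
    y ∈ (M.face i x).carrier ↔ M.SameFace i x y := Iff.rfl

theorem face_eq_face {i : Set.Icc (-1 : ℤ) n} {x y : V} :
    M.face i x = M.face i y ↔ M.SameFace i x y := by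
  constructor
  · intro h
    rw [← mem_face, h]
    exact SameFace.refl _ _
  · intro h
    ext z
    · rfl
    · exact ⟨fun hz => h.symm.trans hz, fun hz => h.trans hz⟩

theorem Face.eq_face {F : M.Face} {x : V} (hx : x ∈ F.carrier) : F = M.face F.rk x := by
  obtain ⟨i, s, y, rfl⟩ := F
  exact face_eq_face.2 hx

theorem Face.nonempty (F : M.Face) : F.carrier.Nonempty := by
  obtain ⟨x, hx⟩ := F.exists_eq
  exact ⟨x, hx ▸ SameFace.refl _ _⟩

theorem Face.sameFace {F : M.Face} {x y : V} (hx : x ∈ F.carrier) (hy : y ∈ F.carrier) :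
    M.SameFace F.rk x y := by
  rw [F.eq_face hx] at hy
  exact hy

theorem Face.mem_of_sameFace {F : M.Face} {x y : V} (hx : x ∈ F.carrier)
    (h : M.SameFace F.rk x y) : y ∈ F.carrier := by
  rw [F.eq_face hx]
  exact h

instance : PartialOrder M.Face where
  le F G := F.rk ≤ G.rk ∧ (F.carrier ∩ G.carrier).Nonempty
  le_refl F := ⟨le_rfl, by simpa using F.nonempty⟩
  le_trans F G H := by
    rintro ⟨h₁, x, hxF, hxG⟩ ⟨h₂, y, hyG, hyH⟩
    -- Labels above the rank of `G` preserve the face `F`, and labels below it preserve `H`; the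
    -- splitting point therefore lies in both.
    obtain ⟨z, hz₁, hz₂⟩ := (Face.sameFace hxG hyG).exists_split
    exact ⟨h₁.trans h₂, z, Face.mem_of_sameFace hxF (hz₁ _ h₁),
      Face.mem_of_sameFace hyH (hz₂ _ h₂).symm⟩
  le_antisymm F G := by
    rintro ⟨h₁, x, hxF, hxG⟩ ⟨h₂, -⟩
    rw [F.eq_face hxF, G.eq_face hxG, le_antisymm h₁ h₂]

theorem Face.eq_of_le_of_rk_eq {F G : M.Face} (h : F ≤ G) (hr : F.rk = G.rk) : F = G :=
  le_antisymm h ⟨hr.ge, by rw [Set.inter_comm]; exact h.2⟩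

theorem Face.rk_strictMono : StrictMono (Face.rk : M.Face → _) := fun _ _ h =>
  lt_of_le_of_ne h.le.1 fun hr => h.ne (Face.eq_of_le_of_rk_eq h.le hr)

theorem face_le_face {i j : Set.Icc (-1 : ℤ) n} (h : i ≤ j) (x : V) : M.face i x ≤ M.face j x :=
  ⟨h, x, SameFace.refl _ _, SameFace.refl _ _⟩

theorem face_lt_face {i j : Set.Icc (-1 : ℤ) n} (h : i < j) (x : V) : M.face i x < M.face j x :=
  lt_of_le_of_ne (face_le_face h.le x) fun e => h.ne (congrArg Face.rk e)

/-- Comparable faces `F ≤ H ≤ G` have a common point. -/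
theorem Face.exists_mem_of_le_of_le {F H G : M.Face} (h₁ : F ≤ H) (h₂ : H ≤ G) :
    ∃ z, z ∈ F.carrier ∧ z ∈ H.carrier ∧ z ∈ G.carrier := by
  obtain ⟨h₁, x, hxF, hxH⟩ := h₁
  obtain ⟨h₂, y, hyH, hyG⟩ := h₂
  obtain ⟨z, hz₁, hz₂⟩ := (Face.sameFace hxH hyH).exists_split
  exact ⟨z, Face.mem_of_sameFace hxF (hz₁ _ h₁), Face.mem_of_sameFace hxH (hz₁ _ le_rfl),
    Face.mem_of_sameFace hyG (hz₂ _ h₂).symm⟩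

/-! ### Points as maximal chains -/

variable (M)

/-- The maximal chain of the faces at a point. -/
def flagOf (x : V) : Flag M.Face where
  carrier := Set.range fun i => M.face i x
  Chain' := by
    rintro _ ⟨i, rfl⟩ _ ⟨j, rfl⟩ -
    exact (le_total i j).imp (fun h => face_le_face h x) fun h => face_le_face h x
  max_chain' := by
    intro s hs hsub
    refine hsub.antisymm fun H hH => ⟨H.rk, ?_⟩
    by_contra hne
    have hmem : M.face H.rk x ∈ s := hsub ⟨_, rfl⟩
    rcases hs hmem hH hne with h | h
    · exact hne (Face.eq_of_le_of_rk_eq h rfl)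
    · exact hne (Face.eq_of_le_of_rk_eq h rfl).symm

variable {M}

theorem mem_flagOf {F : M.Face} {x : V} : F ∈ M.flagOf x ↔ x ∈ F.carrier := by
  constructor
  · rintro ⟨i, rfl⟩
    exact SameFace.refl _ _
  · intro h
    exact ⟨F.rk, (F.eq_face h).symm⟩

/-- The faces of a chain have a common point. -/
theorem exists_mem_of_isChain [Nonempty V] {s : Set M.Face} (hs : IsChain (· ≤ ·) s) :
    ∃ x, ∀ F ∈ s, x ∈ F.carrier := by
  suffices ∀ m : ℕ, ∃ x, ∀ F ∈ s, (F.rk : ℤ) < m → x ∈ F.carrier by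
    obtain ⟨x, hx⟩ := this (n + 1)
    refine ⟨x, fun F hF => hx F hF ?_⟩
    have := F.rk.2.2
    push_cast
    omega
  intro m
  -- The shift by one makes the base case vacuous, since ranks start at −1.
  suffices ∀ m : ℕ, ∃ x, ∀ F ∈ s, (F.rk : ℤ) + 1 < m → x ∈ F.carrier by
    obtain ⟨x, hx⟩ := this (m + 1)
    exact ⟨x, fun F hF h => hx F hF (by push_cast; omega)⟩
  intro m
  induction m with
  | zero =>
    obtain ⟨x⟩ := ‹Nonempty V›
    refine ⟨x, fun F _ h => ?_⟩
    have := F.rk.2.1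
    push_cast at h
    omega
  | succ m ih =>
    obtain ⟨x, hx⟩ := ih
    by_cases hF : ∃ F ∈ s, (F.rk : ℤ) + 1 = m
    · obtain ⟨F, hF, hFm⟩ := hF
      have huniq : ∀ F' ∈ s, (F'.rk : ℤ) + 1 = m → F' = F := by
        intro F' hF' h'
        have hr : F'.rk = F.rk := Subtype.ext (by omega)
        rcases hs.total hF' hF with h | h
        · exact Face.eq_of_le_of_rk_eq h hr
        · exact (Face.eq_of_le_of_rk_eq h hr.symm).symm
      by_cases hlow : ∃ k : ℤ, ∃ G ∈ s, (G.rk : ℤ) = k ∧ k + 1 < m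
      · obtain ⟨k, ⟨G, hG, rfl, hk⟩, hmax⟩ :=
          Int.exists_greatest_of_bdd ⟨(m : ℤ), fun z ⟨_, _, _, h⟩ => by omega⟩ hlow
        have hGF : G ≤ F := by
          rcases hs.total hG hF with h | h
          · exact h
          · have : (F.rk : ℤ) ≤ G.rk := h.1
            omega
        obtain ⟨h₁, y, hyG, hyF⟩ := hGF
        -- `G` is the highest face of the chain below `F`. Splitting a path inside `G` from `x` to a
        -- point of `F` gives a point that keeps all lower faces of `x` and lies in `F`.
        obtain ⟨z, hz₁, hz₂⟩ := (Face.sameFace (hx G hG hk) hyG).exists_split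
        refine ⟨z, fun H hH hm => ?_⟩
        push_cast at hm
        by_cases hHm : (H.rk : ℤ) + 1 = m
        · rw [huniq H hH hHm]
          exact Face.mem_of_sameFace hyF (hz₂ _ h₁).symm
        · have hHm : (H.rk : ℤ) + 1 < m := by omega
          exact Face.mem_of_sameFace (hx H hH hHm) (hz₁ _ (hmax _ ⟨H, hH, rfl, hHm⟩))
      · obtain ⟨y, hy⟩ := F.nonempty
        refine ⟨y, fun H hH hm => ?_⟩
        push_cast at hm
        by_cases hHm : (H.rk : ℤ) + 1 = m
        · rwa [huniq H hH hHm]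
        · exact absurd ⟨_, H, hH, rfl, by omega⟩ hlow
    · push Not at hF
      refine ⟨x, fun H hH hm => hx H hH ?_⟩
      have := hF H hH
      push_cast at hm
      omega

theorem exists_flagOf_eq [Nonempty V] (Φ : Flag M.Face) : ∃ x, M.flagOf x = Φ := by
  obtain ⟨x, hx⟩ := exists_mem_of_isChain Φ.Chain'
  refine ⟨x, Flag.ext ?_⟩
  exact (Φ.max_chain' (M.flagOf x).Chain' fun F hF => mem_flagOf.2 (hx F hF)).symm

/-! ### Diamond condition and strong connectivity -/

theorem SameFace.path_inter {i k : ℤ} (hik : i < k) {x y : V} (h : M.SameFace i x y)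
    (h' : M.SameFace k x y) : LabelConn M.r (labelsNe n i ∩ labelsNe n k) x y :=
  M.path_inter i k hik x y h h'

/-- The only faces of rank `i` between `i - 1` and `i + 1` at `x` are those at `x` and `r i x`. -/
theorem sameFace_or_of_path {i : Fin n} {x y : V}
    (h : LabelConn M.r (labelsNe n ((i : ℕ) - 1) ∩ labelsNe n ((i : ℕ) + 1)) x y) :
    M.SameFace (i : ℕ) x y ∨ M.SameFace (i : ℕ) (M.r i x) y := by
  -- Without `i - 1` and `i + 1`, every label other than `i` commutes with `i`. Occurrences of `i`
  -- can thus be moved to the start of the path, where they cancel in pairs.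
  set S : Set (Fin n) := {l | (l : ℕ) + 1 < i ∨ (i : ℕ) + 1 < l} with hS
  have hcomm : ∀ l ∈ S, ∀ z, M.r i (M.r l z) = M.r l (M.r i z) :=
    fun l hl z => comm' (Or.symm hl) z
  suffices LabelConn M.r S x y ∨ LabelConn M.r S (M.r i x) y by
    refine this.imp (fun h => h.mono ?_) fun h => h.mono ?_ <;>
    · intro l hl
      simp only [hS, labelsNe, Set.mem_ofPred_eq] at hl ⊢
      omega
  induction h with
  | refl => exact Or.inl (LabelConn.refl _)
  | tail _ h ih =>
    obtain ⟨m, ⟨hm, hm'⟩, rfl⟩ := h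
    by_cases hmi : m = i
    · subst hmi
      rcases ih with h | h
      · exact Or.inr (h.shift hcomm)
      · have := h.shift hcomm
        rw [M.invol] at this
        exact Or.inl this
    · have hmS : m ∈ S := by
        have := Fin.val_ne_of_ne hmi
        simp only [hS, labelsNe, Set.mem_ofPred_eq] at hm hm' ⊢
        omega
      exact ih.imp (fun h => h.trans (LabelConn.step hmS _))
        fun h => h.trans (LabelConn.step hmS _)

/-- By `path_inter`, the common points of `F` and `G` are joined by paths avoiding both ranks. Along
these the middle face takes only the values at `x` and `r i x`, which `separated` keeps distinct. -/
theorem diamond {F G : M.Face} (hFG : F < G) (hr : (G.rk : ℤ) - F.rk = 2) :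
    {H : M.Face | (H.rk : ℤ) = F.rk + 1 ∧ F < H ∧ H < G}.ncard = 2 := by
  obtain ⟨-, x, hxF, hxG⟩ := hFG.le
  have hF := F.rk.2.1
  have hG := G.rk.2.2
  obtain ⟨m, hm⟩ := Int.eq_ofNat_of_zero_le (a := (F.rk : ℤ) + 1) (by omega)
  let i : Fin n := ⟨m, by omega⟩
  let k : Set.Icc (-1 : ℤ) n := ⟨(m : ℤ), by constructor <;> omega⟩
  have hFi : (F.rk : ℤ) = ((i : ℕ) : ℤ) - 1 := by simp only [i]; omega
  have hGi : (G.rk : ℤ) = ((i : ℕ) : ℤ) + 1 := by simp only [i]; omega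
  have hFk : F.rk < k := Subtype.coe_lt_coe.1 (by simp only [k]; omega)
  have hkG : k < G.rk := Subtype.coe_lt_coe.1 (by simp only [k]; omega)
  have hmem : ∀ y, y ∈ F.carrier → y ∈ G.carrier → F < M.face k y ∧ M.face k y < G := by
    intro y hyF hyG
    have h₁ := face_lt_face (M := M) hFk y
    have h₂ := face_lt_face (M := M) hkG y
    rw [← F.eq_face hyF] at h₁
    rw [← G.eq_face hyG] at h₂
    exact ⟨h₁, h₂⟩
  rw [Set.ncard_eq_two]
  refine ⟨M.face k x, M.face k (M.r i x), ?_, ?_⟩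
  · rw [Ne, face_eq_face]
    exact M.separated i x
  · ext H
    simp only [Set.mem_ofPred_eq, Set.mem_insert_iff, Set.mem_singleton_iff]
    constructor
    · rintro ⟨hHr, hFH, hHG⟩
      obtain ⟨z, hzF, hzH, hzG⟩ := Face.exists_mem_of_le_of_le hFH.le hHG.le
      have hHk : H.rk = k := Subtype.ext (by simp only [k]; omega)
      have hp := SameFace.path_inter (i := F.rk) (k := G.rk) (by omega) (Face.sameFace hxF hzF)
        (Face.sameFace hxG hzG)
      rw [hFi, hGi] at hp
      rw [H.eq_face hzH, hHk, face_eq_face, face_eq_face]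
      exact (sameFace_or_of_path hp).imp SameFace.symm SameFace.symm
    · rintro (rfl | rfl)
      · exact ⟨hm.symm, hmem x hxF hxG⟩
      · refine ⟨hm.symm, hmem _ (Face.mem_of_sameFace hxF (sameFace_r ?_ x))
          (Face.mem_of_sameFace hxG (sameFace_r ?_ x))⟩ <;> omega

/-- `path_inter` gives a path from a point of `H` to a point of `H'` that stays inside both `F` and
`G`; the faces met along it form the required sequence. -/
theorem strongly_connected {F G : M.Face} (hr : 3 ≤ (G.rk : ℤ) - F.rk)
    {H H' : M.Face} (hH : H ∈ Set.Ioo F G) (hH' : H' ∈ Set.Ioo F G) :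
    Relation.ReflTransGen
      (fun A B => A ∈ Set.Ioo F G ∧ B ∈ Set.Ioo F G ∧ (A ≤ B ∨ B ≤ A)) H H' := by
  obtain ⟨u, huF, huH, huG⟩ := Face.exists_mem_of_le_of_le hH.1.le hH.2.le
  obtain ⟨w, hwF, hwH, hwG⟩ := Face.exists_mem_of_le_of_le hH'.1.le hH'.2.le
  have hp := SameFace.path_inter (i := F.rk) (k := G.rk) (by omega) (Face.sameFace huF hwF)
    (Face.sameFace huG hwG)
  have hmem : ∀ y, y ∈ F.carrier → y ∈ G.carrier → ∀ k, F.rk < k → k < G.rk →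
      M.face k y ∈ Set.Ioo F G := by
    intro y hyF hyG k hFk hkG
    have h₁ := face_lt_face (M := M) hFk y
    have h₂ := face_lt_face (M := M) hkG y
    rw [← F.eq_face hyF] at h₁
    rw [← G.eq_face hyG] at h₂
    exact ⟨h₁, h₂⟩
  have hjoin : ∀ y, y ∈ F.carrier → y ∈ G.carrier → ∀ a b : Set.Icc (-1 : ℤ) n, F.rk < a →
      a < G.rk → F.rk < b → b < G.rk → Relation.ReflTransGen
        (fun A B => A ∈ Set.Ioo F G ∧ B ∈ Set.Ioo F G ∧ (A ≤ B ∨ B ≤ A))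
          (M.face a y) (M.face b y) := by
    intro y hyF hyG a b h₁ h₂ h₃ h₄
    refine .single ⟨hmem y hyF hyG a h₁ h₂, hmem y hyF hyG b h₃ h₄, ?_⟩
    exact (le_total a b).imp (fun h => face_le_face h y) fun h => face_le_face h y
  suffices ∀ z, LabelConn M.r (labelsNe n F.rk ∩ labelsNe n G.rk) u z →
      z ∈ F.carrier ∧ z ∈ G.carrier ∧ ∀ b : Set.Icc (-1 : ℤ) n, F.rk < b → b < G.rk →
        Relation.ReflTransGen
          (fun A B => A ∈ Set.Ioo F G ∧ B ∈ Set.Ioo F G ∧ (A ≤ B ∨ B ≤ A)) H (M.face b z) by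
    have h := (this w hp).2.2 H'.rk (Face.rk_strictMono hH'.1) (Face.rk_strictMono hH'.2)
    rwa [← Face.eq_face hwH] at h
  intro z hz
  induction hz with
  | refl =>
    refine ⟨huF, huG, fun b h₁ h₂ => ?_⟩
    have := hjoin u huF huG H.rk b (Face.rk_strictMono hH.1) (Face.rk_strictMono hH.2) h₁ h₂
    rwa [← Face.eq_face huH] at this
  | @tail y _ _ h ih =>
    obtain ⟨m, ⟨hmF, hmG⟩, rfl⟩ := h
    obtain ⟨hyF, hyG, ih⟩ := ih
    have hF' := Face.mem_of_sameFace hyF (sameFace_r hmF y)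
    have hG' := Face.mem_of_sameFace hyG (sameFace_r hmG y)
    refine ⟨hF', hG', fun b h₁ h₂ => ?_⟩
    -- At least two ranks lie strictly between, so one of them differs from `m`; its face survives
    -- the step and links the two points.
    obtain ⟨c, hc, hcm⟩ : ∃ c : ℤ, (F.rk < c ∧ c < G.rk) ∧ ((m : ℕ) : ℤ) ≠ c := by
      by_cases h : ((m : ℕ) : ℤ) = F.rk + 1
      · exact ⟨F.rk + 2, by constructor <;> omega, by omega⟩
      · exact ⟨F.rk + 1, by constructor <;> omega, h⟩
    let c' : Set.Icc (-1 : ℤ) n :=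
      ⟨c, by have := F.rk.2.1; omega, by have := G.rk.2.2; omega⟩
    have h := ih c' hc.1 hc.2
    rw [face_eq_face.2 (sameFace_r hcm y : M.SameFace c' _ _)] at h
    exact h.trans (hjoin _ hF' hG' c' b hc.1 hc.2 h₁ h₂)

theorem sameFace_of_mem_flagOf_iff {x y : V} {i : ℤ} (hi : i ∈ Set.Icc (-1 : ℤ) n)
    (h : ∀ F : M.Face, (F.rk : ℤ) = i → (F ∈ M.flagOf x ↔ F ∈ M.flagOf y)) :
    M.SameFace i x y := by
  have := (h (M.face ⟨i, hi⟩ x) rfl).1 (mem_flagOf.2 (SameFace.refl _ _))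
  exact mem_flagOf.1 this

/-! ### The polytope of a flag system -/

variable (M)

/-- The abstract polytope defined by a flag system. -/
def toPolytope [Nonempty V] : Polytope.{u} n where
  Face := M.Face
  rank F := F.rk
  rank_strictMono _ _ h := Face.rk_strictMono h
  rank_mem F := F.rk.2
  exists_least := by
    obtain ⟨x⟩ := ‹Nonempty V›
    refine ⟨M.face ⟨-1, le_rfl, by omega⟩ x, fun G => ?_, rfl⟩
    obtain ⟨y, hy⟩ := G.nonempty
    refine ⟨G.rk.2.1, y, (M.connected x y).mono fun l _ => ?_, hy⟩
    simp only [labelsNe, Set.mem_ofPred_eq]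
    omega
  exists_greatest := by
    obtain ⟨x⟩ := ‹Nonempty V›
    refine ⟨M.face ⟨n, by omega, le_rfl⟩ x, fun G => ?_, rfl⟩
    obtain ⟨y, hy⟩ := G.nonempty
    refine ⟨G.rk.2.2, y, hy, (M.connected x y).mono fun l _ => ?_⟩
    have := l.2
    simp only [labelsNe, Set.mem_ofPred_eq]
    omega
  flag_rank Φ i hi := by
    obtain ⟨x, rfl⟩ := exists_flagOf_eq Φ
    refine ⟨M.face ⟨i, hi⟩ x, ⟨⟨_, rfl⟩, rfl⟩, ?_⟩
    rintro F ⟨hF, rfl⟩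
    exact F.eq_face (mem_flagOf.1 hF)
  diamond _ _ hFG hr := FlagSystem.diamond hFG hr
  strongly_connected _ _ _ hr _ hH _ hH' := strongly_connected hr hH hH'

theorem flagGraph_adj_iff [Nonempty V] (i : Fin n) (x y : V) :
    (M.toPolytope.flagGraph i).Adj (M.flagOf x) (M.flagOf y) ↔ y = M.r i x := by
  constructor
  · rintro ⟨hne, h⟩
    refine (M.adjacent i x y fun k hk hki => ?_).resolve_left fun e => hne (e ▸ rfl)
    exact sameFace_of_mem_flagOf_iff hk fun F hF => h F (by rw [← hF] at hki; exact hki)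
  · rintro rfl
    refine ⟨fun e => M.separated i x (sameFace_of_mem_flagOf_iff (i := (i : ℕ)) ?_ fun F _ => by rw [e]),
      fun (F : M.Face) hF => ?_⟩
    · have := i.2
      constructor <;> omega
    · refine (mem_flagOf (M := M)).trans (Iff.trans ?_ (mem_flagOf (M := M)).symm)
      have hs := sameFace_r (M := M) (i := F.rk) (Ne.symm hF) x
      exact ⟨fun h => Face.mem_of_sameFace h hs, fun h => Face.mem_of_sameFace h hs.symm⟩

/-- When all faces agree, `adjacent` at label 0 leaves only `y = r 0 x` besides equality, and
`separated` excludes it. -/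
theorem flagOf_injective (hn : 0 < n) : Function.Injective M.flagOf := by
  intro x y h
  have hs : ∀ k ∈ Set.Icc (-1 : ℤ) n, M.SameFace k x y :=
    fun k hk => sameFace_of_mem_flagOf_iff hk fun F _ => by rw [h]
  rcases M.adjacent ⟨0, hn⟩ x y fun k hk _ => hs k hk with e | e
  · exact e.symm
  · have h0 := hs ((⟨0, hn⟩ : Fin n) : ℕ) ⟨by simp, by simp⟩
    rw [e] at h0
    exact absurd h0 (M.separated _ x)

/-- A labeled graph whose edges are given by a flag system is polytopal. -/
theorem isPolytopal [Nonempty V] (hn : 0 < n) (G : LabeledGraph n V)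
    (hG : ∀ i x y, (G i).Adj x y ↔ y = M.r i x) : G.IsPolytopal := by
  refine ⟨M.toPolytope, ⟨⟨Equiv.ofBijective M.flagOf
    ⟨M.flagOf_injective hn, exists_flagOf_eq⟩, fun i x y => ?_⟩⟩⟩
  rw [hG]
  exact M.flagGraph_adj_iff i x y

end FlagSystem

/-! ### Adjacent flags of a polytope -/

namespace Polytope

variable {n : ℕ} (P : Polytope.{u} n)

/-- Two flags have the same face of rank `k`. -/
def Agree (k : ℤ) (Φ Ψ : Flag P.Face) : Prop := ∀ F, P.rank F = k → (F ∈ Φ ↔ F ∈ Ψ)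

variable {P} {Φ Ψ Θ : Flag P.Face} {k : ℤ}

theorem Agree.refl (k : ℤ) (Φ : Flag P.Face) : P.Agree k Φ Φ := fun _ _ => Iff.rfl

theorem Agree.symm (h : P.Agree k Φ Ψ) : P.Agree k Ψ Φ := fun F hF => (h F hF).symm

theorem Agree.trans (h : P.Agree k Φ Ψ) (h' : P.Agree k Ψ Θ) : P.Agree k Φ Θ :=
  fun F hF => (h F hF).trans (h' F hF)

theorem eq_of_agree (h : ∀ k, P.Agree k Φ Ψ) : Φ = Ψ :=
  Flag.ext (Set.ext fun F => h _ F rfl)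

theorem exists_mem_rank (Φ : Flag P.Face) (hk : k ∈ Set.Icc (-1 : ℤ) n) :
    ∃ F ∈ Φ, P.rank F = k := by
  obtain ⟨F, h, -⟩ := P.flag_rank Φ k hk
  exact ⟨F, h⟩

theorem eq_of_mem_of_rank_eq {F G : P.Face} (hF : F ∈ Φ) (hG : G ∈ Φ)
    (h : P.rank F = P.rank G) : F = G :=
  (P.flag_rank Φ (P.rank G) (P.rank_mem G)).unique ⟨hF, h⟩ ⟨hG, rfl⟩

theorem lt_of_mem_of_rank_lt {F G : P.Face} (hF : F ∈ Φ) (hG : G ∈ Φ)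
    (h : P.rank F < P.rank G) : F < G := by
  rcases Φ.le_or_le hF hG with h' | h'
  · exact lt_of_le_of_ne h' fun e => h.ne (congrArg _ e)
  · exact absurd (P.rank_strictMono.monotone h') h.not_ge

theorem agree_of_mem {F : P.Face} (hΦ : F ∈ Φ) (hΨ : F ∈ Ψ) : P.Agree (P.rank F) Φ Ψ := by
  intro G hG
  constructor <;> intro h
  · rwa [eq_of_mem_of_rank_eq h hΦ hG]
  · rwa [eq_of_mem_of_rank_eq h hΨ hG]

/-- Given the faces of rank `i - 1` and `i + 1`, there are only two choices for that of rank `i`. -/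
theorem Agree.of_not_agree (i : Fin n) (h₁ : P.Agree ((i : ℕ) - 1) Φ Ψ)
    (h₂ : P.Agree ((i : ℕ) + 1) Φ Ψ) (h₁' : P.Agree ((i : ℕ) - 1) Φ Θ)
    (h₂' : P.Agree ((i : ℕ) + 1) Φ Θ) (hΨ : ¬ P.Agree (i : ℕ) Φ Ψ)
    (hΘ : ¬ P.Agree (i : ℕ) Φ Θ) : P.Agree (i : ℕ) Ψ Θ := by
  have hi := i.2
  obtain ⟨A, hA, hAr⟩ := exists_mem_rank Φ (k := (i : ℕ) - 1) (by constructor <;> omega)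
  obtain ⟨B, hB, hBr⟩ := exists_mem_rank Φ (k := (i : ℕ) + 1) (by constructor <;> omega)
  have hmid : ∀ {Ξ : Flag P.Face} {H}, A ∈ Ξ → B ∈ Ξ → H ∈ Ξ → P.rank H = (i : ℕ) →
      H ∈ {H | P.rank H = P.rank A + 1 ∧ A < H ∧ H < B} := fun hA' hB' hH hHr =>
    ⟨by omega, lt_of_mem_of_rank_lt hA' hH (by omega), lt_of_mem_of_rank_lt hH hB' (by omega)⟩
  have hcard := P.diamond A B (lt_of_mem_of_rank_lt hA hB (by omega)) (by omega)
  obtain ⟨a, b, -, hab⟩ := Set.ncard_eq_two.1 hcard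
  rw [hab] at hmid
  have hik : ((i : ℕ) : ℤ) ∈ Set.Icc (-1 : ℤ) n := by constructor <;> omega
  obtain ⟨H, hH, hHr⟩ := exists_mem_rank Φ hik
  obtain ⟨H₁, hH₁, hHr₁⟩ := exists_mem_rank Ψ hik
  obtain ⟨H₂, hH₂, hHr₂⟩ := exists_mem_rank Θ hik
  have hm := hmid hA hB hH hHr
  have hm₁ := hmid ((h₁ A hAr).1 hA) ((h₂ B hBr).1 hB) hH₁ hHr₁
  have hm₂ := hmid ((h₁' A hAr).1 hA) ((h₂' B hBr).1 hB) hH₂ hHr₂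
  have hne₁ : H₁ ≠ H := by rintro rfl; exact hΨ (hHr ▸ agree_of_mem hH hH₁)
  have hne₂ : H₂ ≠ H := by rintro rfl; exact hΘ (hHr ▸ agree_of_mem hH hH₂)
  have heq : H₁ = H₂ := by
    simp only [Set.mem_insert_iff, Set.mem_singleton_iff] at hm hm₁ hm₂
    grind
  subst heq
  exact hHr₁ ▸ agree_of_mem hH₁ hH₂

/-- The diamond condition supplies a second face of rank `i`; exchanging it for the old one leaves a
chain, which extends to a flag. -/
theorem exists_adjacent (i : Fin n) (Φ : Flag P.Face) :
    ∃ Ψ, (∀ k ≠ ((i : ℕ) : ℤ), P.Agree k Φ Ψ) ∧ ¬ P.Agree (i : ℕ) Φ Ψ := by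
  have hi := i.2
  obtain ⟨A, hA, hAr⟩ := exists_mem_rank Φ (k := (i : ℕ) - 1) (by constructor <;> omega)
  obtain ⟨B, hB, hBr⟩ := exists_mem_rank Φ (k := (i : ℕ) + 1) (by constructor <;> omega)
  obtain ⟨H, hH, hHr⟩ := exists_mem_rank Φ (k := (i : ℕ)) (by constructor <;> omega)
  have hcard := P.diamond A B (lt_of_mem_of_rank_lt hA hB (by omega)) (by omega)
  obtain ⟨H', ⟨hHr', hAH', hHB'⟩, hne⟩ :=
    Set.exists_ne_of_one_lt_ncard (s := {H | P.rank H = P.rank A + 1 ∧ A < H ∧ H < B})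
      (by omega) H
  have hchain : IsChain (· ≤ ·) (insert H' {F | F ∈ Φ ∧ P.rank F ≠ (i : ℕ)}) := by
    refine IsChain.insert (Φ.Chain'.mono fun F hF => hF.1) fun F hF _ => ?_
    obtain ⟨hF, hFr⟩ := hF
    rcases lt_or_gt_of_ne hFr with h | h
    · refine Or.inr (le_trans ?_ hAH'.le)
      rcases eq_or_lt_of_le (show P.rank F ≤ P.rank A by omega) with h' | h'
      · exact (eq_of_mem_of_rank_eq hF hA h').le
      · exact (lt_of_mem_of_rank_lt hF hA h').le
    · refine Or.inl (le_trans hHB'.le ?_)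
      rcases eq_or_lt_of_le (show P.rank B ≤ P.rank F by omega) with h' | h'
      · exact (eq_of_mem_of_rank_eq hB hF h').le
      · exact (lt_of_mem_of_rank_lt hB hF h').le
  obtain ⟨Ψ, hΨ⟩ := hchain.exists_subset_flag
  refine ⟨Ψ, fun k hk F hF => ?_, fun h => hne ?_⟩
  · obtain ⟨G, hG, hGr⟩ := exists_mem_rank Φ (hF ▸ P.rank_mem F)
    have := agree_of_mem hG (hΨ (Or.inr ⟨hG, by omega⟩) : G ∈ Ψ)
    exact this F (by omega)
  · exact eq_of_mem_of_rank_eq (hΨ (Or.inl rfl) : H' ∈ Ψ) ((h H hHr).1 hH) (by omega)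

/-- The flag that differs from `Φ` exactly in the face of rank `i`. -/
noncomputable def adj (i : Fin n) (Φ : Flag P.Face) : Flag P.Face := (exists_adjacent i Φ).choose

theorem agree_adj {i : Fin n} (hk : k ≠ (i : ℕ)) (Φ : Flag P.Face) : P.Agree k Φ (adj i Φ) :=
  (exists_adjacent i Φ).choose_spec.1 k hk

theorem not_agree_adj (i : Fin n) (Φ : Flag P.Face) : ¬ P.Agree (i : ℕ) Φ (adj i Φ) :=
  (exists_adjacent i Φ).choose_spec.2

theorem adj_ne (i : Fin n) (Φ : Flag P.Face) : adj i Φ ≠ Φ := fun h =>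
  not_agree_adj i Φ (h.symm ▸ Agree.refl _ _)

theorem eq_adj {i : Fin n} (h : ∀ k ≠ ((i : ℕ) : ℤ), P.Agree k Φ Ψ)
    (h' : ¬ P.Agree (i : ℕ) Φ Ψ) : Ψ = adj i Φ := by
  refine eq_of_agree fun k => ?_
  by_cases hk : k = (i : ℕ)
  · subst hk
    exact Agree.of_not_agree i (h _ (by omega)) (h _ (by omega)) (agree_adj (by omega) _)
      (agree_adj (by omega) _) h' (not_agree_adj i Φ)
  · exact (h k hk).symm.trans (agree_adj hk Φ)

theorem adj_adj (i : Fin n) (Φ : Flag P.Face) : adj i (adj i Φ) = Φ :=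
  (eq_adj (fun _ hk => (agree_adj hk Φ).symm) fun h => not_agree_adj i Φ h.symm).symm

theorem eq_or_eq_adj {i : Fin n} (h : ∀ k ≠ ((i : ℕ) : ℤ), P.Agree k Φ Ψ) :
    Ψ = Φ ∨ Ψ = adj i Φ := by
  by_cases h' : P.Agree (i : ℕ) Φ Ψ
  · left
    refine (eq_of_agree fun k => ?_).symm
    by_cases hk : k = (i : ℕ)
    · exact hk ▸ h'
    · exact h k hk
  · exact Or.inr (eq_adj h h')

theorem flagGraph_adj_iff {i : Fin n} : (P.flagGraph i).Adj Φ Ψ ↔ Ψ = adj i Φ := by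
  constructor
  · rintro ⟨hne, h⟩
    exact (eq_or_eq_adj fun k hk F hF => h F (by rwa [hF])).resolve_left hne.symm
  · rintro rfl
    exact ⟨(adj_ne i Φ).symm, fun F hF => agree_adj hF Φ F rfl⟩

/-- Both sides differ from `Φ` exactly in ranks `i` and `j`. As these are not consecutive, the faces
of neighbouring ranks are unchanged, and the diamond condition determines each new face. -/
theorem adj_comm {i j : Fin n} (hij : (i : ℕ) + 1 < j) (Φ : Flag P.Face) :
    adj i (adj j Φ) = adj j (adj i Φ) := by
  have hij' : ∀ k : ℤ, k ≠ (i : ℕ) → k ≠ (j : ℕ) → P.Agree k Φ (adj i (adj j Φ)) :=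
    fun k hi hj => (agree_adj hj Φ).trans (agree_adj hi _)
  have hji' : ∀ k : ℤ, k ≠ (i : ℕ) → k ≠ (j : ℕ) → P.Agree k Φ (adj j (adj i Φ)) :=
    fun k hi hj => (agree_adj hi Φ).trans (agree_adj hj _)
  refine eq_of_agree fun k => ?_
  by_cases hi : k = (i : ℕ)
  · subst hi
    refine Agree.of_not_agree i (hij' _ ?_ ?_) (hij' _ ?_ ?_) (hji' _ ?_ ?_) (hji' _ ?_ ?_)
      (fun h => not_agree_adj i (adj j Φ) ((agree_adj ?_ Φ).symm.trans h))
      (fun h => not_agree_adj i Φ (h.trans (agree_adj ?_ _).symm)) <;> omega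
  by_cases hj : k = (j : ℕ)
  · subst hj
    refine Agree.of_not_agree j (hij' _ ?_ ?_) (hij' _ ?_ ?_) (hji' _ ?_ ?_) (hji' _ ?_ ?_)
      (fun h => not_agree_adj j Φ (h.trans (agree_adj ?_ _).symm))
      (fun h => not_agree_adj j (adj i Φ) ((agree_adj ?_ Φ).symm.trans h)) <;> omega
  exact (hij' k hi hj).symm.trans (hji' k hi hj)

theorem agree_of_labelConn {x y : Flag P.Face} (h : LabelConn adj (labelsNe n k) x y) :
    P.Agree k x y := by
  induction h with
  | refl => exact Agree.refl _ _
  | tail _ h ih =>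
    obtain ⟨j, hj, rfl⟩ := h
    exact ih.trans (agree_adj (Ne.symm hj) _)

/-- Only ranks −1 and `n` carry faces without being labels, and the least and greatest faces lie in
every flag. -/
theorem agree_of_forall_ne (hk : ∀ i : Fin n, k ≠ (i : ℕ)) (Φ Ψ : Flag P.Face) :
    P.Agree k Φ Ψ := by
  intro F hF
  have hmem := P.rank_mem F
  have hk' : k = -1 ∨ k = n := by
    by_contra! h
    obtain ⟨m, hm⟩ := Int.eq_ofNat_of_zero_le (a := k) (by have := hmem.1; omega)
    exact hk ⟨m, by have := hmem.2; omega⟩ hm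
  rcases hk' with rfl | rfl
  · obtain ⟨A, hA, hAr⟩ := P.exists_least
    have h : ∀ Ξ : Flag P.Face, A ∈ Ξ :=
      fun Ξ => Flag.mem_iff_forall_le_or_ge.2 fun b _ => Or.inl (hA b)
    exact agree_of_mem (h Φ) (h Ψ) F (hF.trans hAr.symm)
  · obtain ⟨A, hA, hAr⟩ := P.exists_greatest
    have h : ∀ Ξ : Flag P.Face, A ∈ Ξ :=
      fun Ξ => Flag.mem_iff_forall_le_or_ge.2 fun b _ => Or.inr (hA b)
    exact agree_of_mem (h Φ) (h Ψ) F (hF.trans hAr.symm)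

end Polytope

/-! ### Words in two involutions -/

section Dihedral

variable {G : Type u} [Group G] {a b : G}

/-- An odd word in two involutions `a`, `b` is a conjugate of `a` or of `b`. -/
theorem exists_conj_eq_of_involutions (ha : a * a = 1) (hb : b * b = 1) (m : ℤ) :
    ∃ g : G, b * (a * b) ^ m = g⁻¹ * b * g ∨ b * (a * b) ^ m = g⁻¹ * a * g := by
  -- Conjugation by `b` inverts `a * b`, so half of the exponent can be moved across `b`; the parity
  -- of `m` decides which generator remains in the middle.
  have hinv : ∀ l : ℤ, b * (a * b) ^ l = (a * b) ^ (-l) * b := by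
    intro l
    have h : b * (a * b) * b⁻¹ = (a * b)⁻¹ := by
      rw [mul_inv_rev, inv_eq_of_mul_eq_one_left ha, inv_eq_of_mul_eq_one_left hb,
        mul_assoc, mul_assoc, hb, mul_one]
    rw [zpow_neg, ← inv_zpow, ← h, conj_zpow, inv_mul_cancel_right]
  rcases Int.even_or_odd' m with ⟨l, rfl | rfl⟩
  · refine ⟨(a * b) ^ l, Or.inl ?_⟩
    rw [two_mul, zpow_add, ← mul_assoc, hinv, zpow_neg]
  · refine ⟨b * (a * b) ^ l, Or.inr ?_⟩
    have hb' : b⁻¹ = b := inv_eq_of_mul_eq_one_left hb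
    calc b * (a * b) ^ (2 * l + 1) = b * (a * b) ^ l * (a * b) * (a * b) ^ l := by
          rw [show 2 * l + 1 = l + 1 + l by ring, zpow_add, zpow_add_one]
          simp only [mul_assoc]
      _ = (b * (a * b) ^ l)⁻¹ * a * (b * (a * b) ^ l) := by
          rw [mul_inv_rev, hb', ← zpow_neg]
          nth_rewrite 1 [hinv]
          simp only [mul_assoc]

theorem mul_mul_zpow_of_involution (ha : a * a = 1) (m : ℤ) :
    a * (a * b) ^ m = b * (a * b) ^ (m - 1) := by
  rw [show (a * b) ^ m = a * b * (a * b) ^ (m - 1) by rw [← zpow_one_add, add_sub_cancel],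
    ← mul_assoc, ← mul_assoc, ha, one_mul]

theorem Equiv.Perm.mul_zpow_apply_ne {α : Type u} {a b : Equiv.Perm α} (ha : a * a = 1)
    (hb : b * b = 1) (ha' : ∀ x, a x ≠ x) (hb' : ∀ x, b x ≠ x) (m : ℤ) (x : α) :
    (b * (a * b) ^ m) x ≠ x := by
  obtain ⟨g, h | h⟩ := exists_conj_eq_of_involutions ha hb m <;> rw [h] <;> intro e
  · exact hb' (g x) (Equiv.Perm.inv_eq_iff_eq.1 e)
  · exact ha' (g x) (Equiv.Perm.inv_eq_iff_eq.1 e)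

end Dihedral

/-! ### Pairs of flags -/

namespace Polytope

variable {n : ℕ} {P : Polytope.{u} n} {Q : Polytope.{v} n}

/-- The permutation of the flags that exchanges `i`-adjacent flags. -/
noncomputable def adjPerm (P : Polytope.{u} n) (i : Fin n) : Equiv.Perm (Flag P.Face) :=
  (show Function.Involutive (adj i) from adj_adj i).toPerm

theorem adjPerm_mul_self (i : Fin n) : P.adjPerm i * P.adjPerm i = 1 :=
  Equiv.ext fun Φ => adj_adj i Φ

/-- The simultaneous passage to `i`-adjacent flags in two polytopes. -/
noncomputable def pairAdj (i : Fin n) (x : Flag P.Face × Flag Q.Face) :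
    Flag P.Face × Flag Q.Face := (adj i x.1, adj i x.2)

/-- The point is that one exponent and one parity serve both coordinates. -/
theorem exists_zpow_of_labelConn {i j : Fin n} {x y : Flag P.Face × Flag Q.Face}
    (h : LabelConn pairAdj {i, j} x y) : ∃ m : ℤ,
      (y.1 = ((P.adjPerm i * P.adjPerm j) ^ m) x.1 ∧
        y.2 = ((Q.adjPerm i * Q.adjPerm j) ^ m) x.2) ∨
      (y.1 = (P.adjPerm j * (P.adjPerm i * P.adjPerm j) ^ m) x.1 ∧
        y.2 = (Q.adjPerm j * (Q.adjPerm i * Q.adjPerm j) ^ m) x.2) := by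
  induction h with
  | refl => exact ⟨0, Or.inl ⟨rfl, rfl⟩⟩
  | @tail y _ _ h ih =>
    obtain ⟨l, hl, rfl⟩ := h
    obtain ⟨m, ⟨h₁, h₂⟩ | ⟨h₁, h₂⟩⟩ := ih <;> rcases hl with rfl | rfl
    · refine ⟨m - 1, Or.inr ⟨?_, ?_⟩⟩ <;>
        rw [← mul_mul_zpow_of_involution (adjPerm_mul_self _),
          Equiv.Perm.mul_apply]
      · exact congrArg (adj _) h₁
      · exact congrArg (adj _) h₂
    · exact ⟨m, Or.inr ⟨congrArg (adj _) h₁, congrArg (adj _) h₂⟩⟩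
    · refine ⟨1 + m, Or.inl ⟨?_, ?_⟩⟩ <;> rw [zpow_one_add, mul_assoc, Equiv.Perm.mul_apply]
      · exact congrArg (adj _) h₁
      · exact congrArg (adj _) h₂
    · refine ⟨m, Or.inl ⟨?_, ?_⟩⟩
      · change adj _ y.1 = _
        rw [h₁]; exact adj_adj _ _
      · change adj _ y.2 = _
        rw [h₂]; exact adj_adj _ _

/-- If two pairs of flags are joined by labels `i` and `j` and their entries are equal or
`j`-adjacent, then the pairs are equal or `j`-adjacent. -/
theorem eq_or_eq_pairAdj {i j : Fin n} {x y : Flag P.Face × Flag Q.Face}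
    (h : LabelConn pairAdj {i, j} x y) (h₁ : y.1 = x.1 ∨ y.1 = adj j x.1)
    (h₂ : y.2 = x.2 ∨ y.2 = adj j x.2) : y = x ∨ y = pairAdj j x := by
  obtain ⟨m, ⟨e₁, e₂⟩ | ⟨e₁, e₂⟩⟩ := exists_zpow_of_labelConn h
  · left
    refine Prod.ext (h₁.resolve_right fun h => ?_) (h₂.resolve_right fun h => ?_)
    -- If an even word led to the `j`-adjacent flag, prefixing `j` would give an odd word with a
    -- fixed point.
    · refine Equiv.Perm.mul_zpow_apply_ne (adjPerm_mul_self i) (adjPerm_mul_self j) (adj_ne i)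
        (adj_ne j) m x.1 ?_
      rw [Equiv.Perm.mul_apply, ← e₁, h]
      exact adj_adj _ _
    · refine Equiv.Perm.mul_zpow_apply_ne (adjPerm_mul_self i) (adjPerm_mul_self j) (adj_ne i)
        (adj_ne j) m x.2 ?_
      rw [Equiv.Perm.mul_apply, ← e₂, h]
      exact adj_adj _ _
  · right
    refine Prod.ext (h₁.resolve_left fun h => ?_) (h₂.resolve_left fun h => ?_)
    · exact Equiv.Perm.mul_zpow_apply_ne (adjPerm_mul_self i) (adjPerm_mul_self j) (adj_ne i)
        (adj_ne j) m x.1 (e₁.symm.trans h)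
    · exact Equiv.Perm.mul_zpow_apply_ne (adjPerm_mul_self i) (adjPerm_mul_self j) (adj_ne i)
        (adj_ne j) m x.2 (e₂.symm.trans h)

theorem parallelProduct_adj_iff {i : Fin n} {x y : Flag P.Face × Flag Q.Face} :
    (P.flagGraph.parallelProduct Q.flagGraph i).Adj x y ↔ y = pairAdj i x :=
  (and_congr flagGraph_adj_iff flagGraph_adj_iff).trans
    (Prod.ext_iff (x := y) (y := pairAdj i x)).symm

theorem mem_component_iff {x y : Flag P.Face × Flag Q.Face} :
    y ∈ (P.flagGraph.parallelProduct Q.flagGraph).component x ↔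
      LabelConn pairAdj Set.univ x y := by
  change SimpleGraph.Reachable _ _ _ ↔ _
  rw [SimpleGraph.reachable_iff_reflTransGen]
  have : (P.flagGraph.parallelProduct Q.flagGraph).toGraph.Adj =
      fun x y => ∃ j ∈ (Set.univ : Set (Fin n)), y = pairAdj j x := by
    ext x y
    refine SimpleGraph.iSup_adj.trans ?_
    simp only [parallelProduct_adj_iff, Set.mem_univ, true_and]
  rw [this]
  rfl

end Polytope

/-! ### The mix as a flag system -/

namespace RootedPolytope

open Polytope

variable {n : ℕ} (P : RootedPolytope.{u} n) (Q : RootedPolytope.{v} n)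

/-- The vertices of the mix. -/
abbrev MixVertex : Type (max u v) :=
  (P.flagGraph.parallelProduct Q.flagGraph).component (P.base, Q.base)

variable {P Q}

/-- The `i`-adjacent vertex of the mix. -/
noncomputable def mixAdj (i : Fin n) (x : P.MixVertex Q) : P.MixVertex Q :=
  ⟨pairAdj i x.1, mem_component_iff.2
    ((mem_component_iff.1 x.2).trans (LabelConn.step (Set.mem_univ i) x.1))⟩

theorem mixAdj_mixAdj (i : Fin n) (x : P.MixVertex Q) : mixAdj i (mixAdj i x) = x :=
  Subtype.ext (Prod.ext (adj_adj i _) (adj_adj i _))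

theorem labelConn_val {S : Set (Fin n)} {x y : P.MixVertex Q} (h : LabelConn mixAdj S x y) :
    LabelConn pairAdj S x.1 y.1 := h.map Subtype.val fun _ _ => rfl

theorem labelConn_of_val {S : Set (Fin n)} {x : P.MixVertex Q}
    {y : Flag P.Face × Flag Q.Face} (h : LabelConn pairAdj S x.1 y) :
    ∃ hy, LabelConn mixAdj S x ⟨y, hy⟩ := by
  induction h with
  | refl => exact ⟨x.2, LabelConn.refl _⟩
  | tail _ h ih =>
    obtain ⟨j, hj, rfl⟩ := h
    obtain ⟨hy, ih⟩ := ih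
    exact ⟨_, ih.trans (LabelConn.step hj _)⟩

theorem mix_connected (x y : P.MixVertex Q) : LabelConn mixAdj Set.univ x y := by
  have key : ∀ z : P.MixVertex Q,
      LabelConn mixAdj Set.univ ⟨(P.base, Q.base), mem_component_iff.2 (LabelConn.refl _)⟩ z :=
    fun z => (labelConn_of_val (mem_component_iff.1 z.2)).2
  exact ((key x).symm mixAdj_mixAdj).trans (key y)

theorem agree_fst {k : ℤ} {x y : P.MixVertex Q} (h : LabelConn mixAdj (labelsNe n k) x y) :
    P.Agree k x.1.1 y.1.1 :=
  agree_of_labelConn (h.map (fun z : P.MixVertex Q => z.1.1) fun _ _ => rfl)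

theorem agree_snd {k : ℤ} {x y : P.MixVertex Q} (h : LabelConn mixAdj (labelsNe n k) x y) :
    Q.Agree k x.1.2 y.1.2 :=
  agree_of_labelConn (h.map (fun z : P.MixVertex Q => z.1.2) fun _ _ => rfl)

theorem mix_adj_iff {i : Fin n} {x y : P.MixVertex Q} :
    (P.mix Q i).Adj x y ↔ y = mixAdj i x :=
  (parallelProduct_adj_iff (x := x.1) (y := y.1)).trans
    (Subtype.ext_iff (a1 := y) (a2 := mixAdj i x)).symm

/-- Two vertices of a mix of polyhedra with the same faces of two ranks are equal or adjacent. -/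
theorem eq_or_eq_mixAdj {P : RootedPolytope.{u} 3} {Q : RootedPolytope.{v} 3} {i k l : Fin 3}
    (hik : i ≠ k) (hil : i ≠ l) (hkl : k ≠ l) {x y : P.MixVertex Q}
    (hi : LabelConn mixAdj (labelsNe 3 (i : ℕ)) x y)
    (hk : LabelConn mixAdj (labelsNe 3 (k : ℕ)) x y) : y = x ∨ y = mixAdj l x := by
  have hcover : ∀ j : Fin 3, j = i ∨ j = k ∨ j = l := by omega
  have hfst : ∀ m ≠ ((l : ℕ) : ℤ), P.Agree m x.1.1 y.1.1 := by
    intro m hm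
    by_cases h : ∃ j : Fin 3, m = (j : ℕ)
    · obtain ⟨j, rfl⟩ := h
      rcases hcover j with rfl | rfl | rfl
      exacts [agree_fst hi, agree_fst hk, absurd rfl hm]
    · exact agree_of_forall_ne (not_exists.1 h) _ _
  have hsnd : ∀ m ≠ ((l : ℕ) : ℤ), Q.Agree m x.1.2 y.1.2 := by
    intro m hm
    by_cases h : ∃ j : Fin 3, m = (j : ℕ)
    · obtain ⟨j, rfl⟩ := h
      rcases hcover j with rfl | rfl | rfl
      exacts [agree_snd hi, agree_snd hk, absurd rfl hm]
    · exact agree_of_forall_ne (not_exists.1 h) _ _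
  -- Rank 3 enters here: avoiding `i` leaves just two labels, so the path is a dihedral word.
  have hpath : LabelConn pairAdj {k, l} x.1 y.1 := by
    refine (labelConn_val hi).mono fun j hj => (hcover j).resolve_left ?_
    rintro rfl
    exact hj rfl
  exact (eq_or_eq_pairAdj hpath (eq_or_eq_adj hfst) (eq_or_eq_adj hsnd)).imp
    (fun h => Subtype.ext h) fun h => Subtype.ext h

/-- The mix of two polyhedra as a flag system. -/
noncomputable def mixFlagSystem (P : RootedPolytope.{u} 3) (Q : RootedPolytope.{v} 3) :
    FlagSystem 3 (P.MixVertex Q) where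
  r := mixAdj
  invol := mixAdj_mixAdj
  comm _ _ hij _ := Subtype.ext (Prod.ext (adj_comm hij _) (adj_comm hij _))
  connected := mix_connected
  separated i x h := not_agree_adj i x.1.1 (agree_fst h)
  path_inter i k hlt x y hi hk := by
    -- If `i` or `k` is not a label, avoiding it is no restriction and the other path already
    -- suffices.
    by_cases hi' : ∃ j : Fin 3, i = (j : ℕ)
    · by_cases hk' : ∃ j : Fin 3, k = (j : ℕ)
      · obtain ⟨i, rfl⟩ := hi'
        obtain ⟨k, rfl⟩ := hk'
        have hik : i ≠ k := by rintro rfl; omega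
        obtain ⟨l, hil, hkl⟩ : ∃ l, i ≠ l ∧ k ≠ l := by
          clear hi hk hlt
          decide +revert
        rcases eq_or_eq_mixAdj hik hil hkl hi hk with rfl | rfl
        · exact LabelConn.refl _
        · have hl : l ∈ labelsNe 3 (i : ℕ) ∩ labelsNe 3 (k : ℕ) := by
            simp only [labelsNe, Set.mem_inter_iff, Set.mem_ofPred_eq]
            omega
          exact LabelConn.step hl x
      · exact hi.mono fun j hj => ⟨hj, fun e => hk' ⟨j, e.symm⟩⟩
    · exact hk.mono fun j hj => ⟨fun e => hi' ⟨j, e.symm⟩, hj⟩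
  adjacent i x y h := by
    obtain ⟨k, l, hkl, hki, hli⟩ : ∃ k l, k ≠ l ∧ k ≠ i ∧ l ≠ i := by
      clear h
      decide +revert
    refine eq_or_eq_mixAdj hkl hki hli (h _ ?_ ?_) (h _ ?_ ?_) <;>
      first | omega | constructor <;> omega

end RootedPolytope

theorem mainTheorem1 (P : RootedPolytope.{u} 3) (Q : RootedPolytope.{v} 3) :
    (P.mix Q).IsPolytopal := by
  have : Nonempty (P.MixVertex Q) :=
    ⟨⟨(P.base, Q.base), Polytope.mem_component_iff.2 (LabelConn.refl _)⟩⟩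
  exact (P.mixFlagSystem Q).isPolytopal (by omega) _ fun _ _ _ => RootedPolytope.mix_adj_iff
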